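/- Conventions. In a partial order $P$, $p\le q$ means that $q$ is stronger than $p$; $p,q$ are compatible if they have a common upper bound. $P$ is separative if whenever $p\not\le q$ there is $r\ge q$ incompatible with $p$, and $P$ satisfies the countable chain condition if every set of pairwise incompatible elements is countable. For subsets $S,T$ of a partial order with the induced orders, $S$ is completely contained in $T$ if $S\subseteq T$, elements incompatible in $S$ are incompatible in $T$, and for every $t\in T$ there is $s\in S$ such that every $s'\in S$ with $s'\ge s$ is compatible with $t$ in $T$. $B(P)$ denotes the completion of $P$, i.e. the (up to isomorphism unique) complete Boolean algebra in which $P$ embeds, order-reversingly and with incompatible elements going to disjoint ones, as a dense subset. $\langle S\rangle^{cm}$ denotes the subalgebra completely generated by $S$. For Boolean algebras $B\le D$, $\pi(D/B)$ is the least cardinality of a set $A\subseteq D$ such that $A\cup B$ generates a dense subalgebra of $D$. A set $\mathbb C\subseteq[\kappa]^{\omega_1}=\{X\subseteq\kappa:|X|=\omega_1\}$ is club if every $S\in[\kappa]^{\omega_1}$ is included in some $X\in\mathbb C$, and the union of every nonempty $\subseteq$-chain of at most $\omega_1$ elements of $\mathbb C$ is in $\mathbb C$. Lemma. Let $\kappa\ge\omega_2$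 be a cardinal and, for every $X\subseteq\kappa$, let $P_X$ and $Q_X$ be separative partial orders such that: (a) every $P_X$ and every $Q_X$ satisfies the countable chain condition; (b) if $X\subseteq Y\subseteq\kappa$, then $P_X\subseteq P_Y$ and $P_X$ is completely contained in $P_Y$; similarly $Q_X$ is completely contained in $Q_Y$. Accordingly, write $A_X$ for the copy of $B(P_X)$ inside $A_\kappa=B(P_\kappa)$, i.e. the complete subalgebra of $B(P_\kappa)$ completely generated by $P_X$, in which $P_X$ is dense; similarly $B_X$ for the copy of $B(Q_X)$ inside $B_\kappa=B(Q_\kappa)$; (c) $P_X=\bigcup\{P_e: e\subseteq X\text{ finite}\}$ and $Q_X=\bigcup\{Q_e: e\subseteq X\text{ finite}\}$ for all $X\subseteq\kappa$; (d) $|P_X|\le|X|$ and $|Q_X|\le|X|$ for all infinite $X\subseteq\kappa$; (e) $A_{X\cup Y}=\langle A_X\cup A_Y\rangle^{cm}$ and $B_{X\cup Y}=\langle B_X\cup B_Y\rangle^{cm}$ for all $X,Y\subseteq\kappa$; (f) $\pi(A_{X\cup Y}/A_X)\le\omega$ for all $X\subseteq\kappa$ and all countable $Y\subseteq\kappa$.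 Assume that $B_\kappa$ is isomorphic to $A_\kappa$. Then there is a club subset $\mathbb C$ of $[\kappa]^{\omega_1}$ such that $\pi(B_{X\cup Y}/B_X)\le\omega$ for all $X\in\mathbb C$ and all countable $Y\subseteq\kappa$. -/

import Mathlib

open Cardinal

universe u

/-! ### Partial orders as notions of forcing

Throughout, `p ≤ q` means that the condition `q` is stronger than `p`. -/

/-- Two conditions are compatible if they have a common extension. -/
def Compat {P : Type u} [PartialOrder P] (p q : P) : Prop :=
  ∃ r, p ≤ r ∧ q ≤ r

/-- `P` is separative: if `p ≰ q` then some extension of `q` is incompatible with `p`. -/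
def Separative (P : Type u) [PartialOrder P] : Prop :=
  ∀ p q : P, ¬ p ≤ q → ∃ r, q ≤ r ∧ ¬ Compat r p

/-- The countable chain condition: every set of pairwise incompatible conditions is countable. -/
def CountableChainCondition (P : Type u) [PartialOrder P] : Prop :=
  ∀ S : Set P, S.Pairwise (fun p q => ¬ Compat p q) → S.Countable

/-- For subsets `S`, `T` of a partial order, each with the induced order: `S` is completely contained
in `T`, i.e. `S ⊆ T` and the inclusion is a complete embedding. Elements of `S` that are incompatible
in `S` are incompatible in `T`, and each `t ∈ T` has a reduction `s ∈ S`: every extension of `s`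
in `S` is compatible with `t` in `T`. -/
structure CompletelyContained {α : Type u} [PartialOrder α] (S T : Set α) : Prop where
  subset : S ⊆ T
  compat : ∀ p q : S, Compat (Set.inclusion subset p) (Set.inclusion subset q) → Compat p q
  reduction : ∀ t : T, ∃ s : S, ∀ s' : S, s ≤ s' → Compat (Set.inclusion subset s') t

/-! ### The completion of a partial order -/

/-- The completion `B(P)` of a partial order `P`: the regular open algebra of `P`. The open sets are
the subsets of `P` closed under extension, i.e. the lower sets of the dual order. -/
def Completion (P : Type u) [PartialOrder P] : Type u :=
  Heyting.Regular (LowerSet Pᵒᵈ)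

namespace Completion

variable {P : Type u} [PartialOrder P]

instance : BooleanAlgebra (Completion P) :=
  inferInstanceAs (BooleanAlgebra (Heyting.Regular (LowerSet Pᵒᵈ)))

noncomputable instance : CompleteBooleanAlgebra (Completion P) :=
  { (inferInstance : BooleanAlgebra (Completion P)) with
    sSup := (Heyting.Regular.gi.liftCompleteLattice
      (α := LowerSet Pᵒᵈ) (β := Heyting.Regular (LowerSet Pᵒᵈ))).sSup
    sInf := (Heyting.Regular.gi.liftCompleteLattice
      (α := LowerSet Pᵒᵈ) (β := Heyting.Regular (LowerSet Pᵒᵈ))).sInf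
    isLUB_sSup := (Heyting.Regular.gi.liftCompleteLattice
      (α := LowerSet Pᵒᵈ) (β := Heyting.Regular (LowerSet Pᵒᵈ))).isLUB_sSup
    isGLB_sInf := (Heyting.Regular.gi.liftCompleteLattice
      (α := LowerSet Pᵒᵈ) (β := Heyting.Regular (LowerSet Pᵒᵈ))).isGLB_sInf }

/-- The canonical order-reversing map `P → B(P)`, sending `p` to the regularization of the open set
of all extensions of `p`. -/
def of (p : P) : Completion P :=
  Heyting.Regular.toRegular (LowerSet.Iic (OrderDual.toDual p))

theorem of_le_iff {p : P} {a : Completion P} :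
    of p ≤ a ↔ OrderDual.toDual p ∈ (Heyting.Regular.val a : LowerSet Pᵒᵈ) :=
  (Heyting.Regular.gi.gc _ _).trans LowerSet.Iic_le

theorem of_anti {p q : P} (h : p ≤ q) : of q ≤ of p :=
  Heyting.Regular.toRegular.monotone (LowerSet.Iic_le.2 h)

/-- The image of `P` is dense in `B(P)`. -/
theorem exists_of_le {a : Completion P} (ha : a ≠ ⊥) : ∃ p : P, of p ≤ a := by
  by_contra! h
  refine ha (le_bot_iff.1 (Heyting.Regular.coe_le_coe.1 fun x hx => ?_))
  exact absurd (of_le_iff.2 hx) (h (OrderDual.ofDual x))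

theorem of_ne_bot (p : P) : of p ≠ ⊥ := by
  intro h
  have h1 := of_le_iff.1 (le_refl (of p))
  rw [h] at h1
  exact LowerSet.notMem_bot h1

/-- Compatibility in `P` is non-disjointness in `B(P)`. -/
theorem disjoint_of_iff {p q : P} : Disjoint (of p) (of q) ↔ ¬ Compat p q := by
  constructor
  · rintro h ⟨r, hp, hq⟩
    exact of_ne_bot r (le_bot_iff.1 (h (of_anti hp) (of_anti hq)))
  · intro h
    have h1 : Disjoint (LowerSet.Iic (OrderDual.toDual p)) (LowerSet.Iic (OrderDual.toDual q)) := by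
      rw [disjoint_iff_inf_le]
      rintro r ⟨hp, hq⟩
      exact (h ⟨OrderDual.ofDual r, hp, hq⟩).elim
    have h2 : of p ≤ (of q)ᶜ := by
      refine of_le_iff.2 ?_
      rw [← LowerSet.Iic_le]
      change _ ≤ (LowerSet.Iic (OrderDual.toDual q))ᶜᶜᶜ
      rw [compl_compl_compl]
      exact le_compl_iff_disjoint_right.2 h1
    exact le_compl_iff_disjoint_right.1 h2

/-- If `P` is separative, the map `P → B(P)` is an order-reversing embedding. -/
theorem of_le_of_iff (hP : Separative P) {p q : P} : of q ≤ of p ↔ p ≤ q := by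
  refine ⟨fun h => ?_, of_anti⟩
  by_contra hpq
  obtain ⟨r, hr, hrp⟩ := hP p q hpq
  have h1 := disjoint_of_iff.2 hrp
  exact of_ne_bot r (le_bot_iff.1 (h1 le_rfl ((of_anti hr).trans h)))

end Completion

/-! ### Completely generated subalgebras and relative π-weight -/

/-- The subalgebra `⟨S⟩^cm` of the complete Boolean algebra `D` completely generated by `S`: the least
subalgebra that includes `S` and is closed under arbitrary sums taken in `D` (hence, by complements,
under arbitrary products). -/
def completeClosure {D : Type u} [CompleteBooleanAlgebra D] (S : Set D) : BooleanSubalgebra D :=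
  sInf {L | S ⊆ L ∧ ∀ M : Set D, M ⊆ L → sSup M ∈ L}

/-- The relative π-weight `π(C/B)` of a subalgebra `C` over a subalgebra `B` (both inside `D`, and
used for `B ≤ C`): the least size of a set `A ⊆ C` such that `A ∪ B` generates a dense subalgebra
of `C`. -/
noncomputable def relPiWeight {D : Type u} [BooleanAlgebra D] (C B : BooleanSubalgebra D) :
    Cardinal.{u} :=
  sInf {c | ∃ A : Set D, A ⊆ C ∧ #A = c ∧
    ∀ d ∈ C, d ≠ ⊥ → ∃ x ∈ BooleanSubalgebra.closure (A ∪ (B : Set D)), x ≠ ⊥ ∧ x ≤ d}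

/-- For subsets `S ⊆ T` of a partial order, the subalgebra of `B(T)` completely generated by `S`.
If `S` is completely contained in `T`, this is the copy of `B(S)` inside `B(T)`; see
`exists_of_le_of_mem_subCompletion` and `nonempty_completion_orderIso`. -/
noncomputable def subCompletion {α : Type u} [PartialOrder α] (S T : Set α) : BooleanSubalgebra (Completion T) :=
  completeClosure (Completion.of '' {p : T | (p : α) ∈ S})

section

variable {α : Type u} [PartialOrder α] {S T : Set α}

theorem subset_completeClosure {D : Type u} [CompleteBooleanAlgebra D] (M : Set D) :
    M ⊆ completeClosure M := fun _ hx =>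
  BooleanSubalgebra.mem_sInf.2 fun _ hL => hL.1 hx

theorem sSup_mem_completeClosure {D : Type u} [CompleteBooleanAlgebra D] {M N : Set D}
    (h : N ⊆ completeClosure M) : sSup N ∈ completeClosure M :=
  BooleanSubalgebra.mem_sInf.2 fun L hL => hL.2 _ fun _ hx =>
    BooleanSubalgebra.mem_sInf.1 (h hx) L hL

/-- If `S` is completely contained in `T`, the elements of `subCompletion S T` are exactly the sums
of subsets of `S`. -/
theorem mem_subCompletion_iff (h : CompletelyContained S T) {a : Completion T} :
    a ∈ subCompletion S T ↔ ∃ M : Set T, (∀ p ∈ M, (p : α) ∈ S) ∧ a = sSup (Completion.of '' M) := by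
  constructor
  · intro ha
    have hcompl : ∀ M : Set T, (∀ p ∈ M, (p : α) ∈ S) → (sSup (Completion.of '' M))ᶜ =
        sSup (Completion.of '' {p : T | (p : α) ∈ S ∧ ∀ q ∈ M, ¬ Compat p q}) := by
      intro M hM
      apply le_antisymm
      · by_contra hcon
        obtain ⟨t, ht⟩ := Completion.exists_of_le (fun hb => hcon (sdiff_eq_bot_iff.1 hb))
        rw [sdiff_eq, le_inf_iff] at ht
        obtain ⟨s, hs⟩ := h.reduction t
        have hmem : Set.inclusion h.subset s ∈
            {p : T | (p : α) ∈ S ∧ ∀ q ∈ M, ¬ Compat p q} := by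
          refine ⟨s.2, fun q hq hc => ?_⟩
          obtain ⟨s', h1, h2⟩ := h.compat s ⟨q, hM q hq⟩ hc
          obtain ⟨r, h3, h4⟩ := hs s' h1
          have h5 : Completion.of r ≤ (sSup (Completion.of '' M))ᶜ := (Completion.of_anti h4).trans ht.1
          have h6 : Completion.of r ≤ sSup (Completion.of '' M) :=
            (Completion.of_anti (le_trans (show q ≤ Set.inclusion h.subset s' from h2) h3)).trans
              (le_sSup ⟨q, hq, rfl⟩)
          exact Completion.of_ne_bot r (le_bot_iff.1 (disjoint_compl_right h6 h5))
        obtain ⟨r, h3, h4⟩ := hs s le_rfl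
        have h5 := (Completion.of_anti h4).trans ht.2
        have h6 := (Completion.of_anti h3).trans (le_sSup (Set.mem_image_of_mem Completion.of hmem))
        exact Completion.of_ne_bot r (le_bot_iff.1 (disjoint_compl_right h6 h5))
      · refine sSup_le ?_
        rintro _ ⟨p, hp, rfl⟩
        rw [le_compl_iff_disjoint_right, disjoint_sSup_iff]
        rintro _ ⟨q, hq, rfl⟩
        exact Completion.disjoint_of_iff.2 (hp.2 q hq)
    have hS : ∀ N : Set (Completion T), (∀ a ∈ N, ∃ M : Set T, (∀ p ∈ M, (p : α) ∈ S) ∧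
        a = sSup (Completion.of '' M)) →
        ∃ M : Set T, (∀ p ∈ M, (p : α) ∈ S) ∧ sSup N = sSup (Completion.of '' M) := by
      intro N hN
      refine ⟨{p | (p : α) ∈ S ∧ Completion.of p ≤ sSup N}, fun p hp => hp.1, le_antisymm ?_ ?_⟩
      · refine sSup_le fun a haN => ?_
        obtain ⟨M, hM, rfl⟩ := hN a haN
        refine sSup_le ?_
        rintro _ ⟨p, hp, rfl⟩
        exact le_sSup ⟨p, ⟨hM p hp, (le_sSup (Set.mem_image_of_mem _ hp)).trans (le_sSup haN)⟩, rfl⟩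
      · refine sSup_le ?_
        rintro _ ⟨p, hp, rfl⟩
        exact hp.2
    have hsup : ∀ {a b : Completion T}, (∃ M : Set T, (∀ p ∈ M, (p : α) ∈ S) ∧
        a = sSup (Completion.of '' M)) → (∃ M : Set T, (∀ p ∈ M, (p : α) ∈ S) ∧
        b = sSup (Completion.of '' M)) → ∃ M : Set T, (∀ p ∈ M, (p : α) ∈ S) ∧
        a ⊔ b = sSup (Completion.of '' M) := by
      intro a b ha hb
      rw [← sSup_pair]
      refine hS _ ?_
      rintro c (rfl | rfl)
      exacts [ha, hb]
    have hc : ∀ {a : Completion T}, (∃ M : Set T, (∀ p ∈ M, (p : α) ∈ S) ∧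
        a = sSup (Completion.of '' M)) → ∃ M : Set T, (∀ p ∈ M, (p : α) ∈ S) ∧
        aᶜ = sSup (Completion.of '' M) := by
      rintro _ ⟨M, hM, rfl⟩
      exact ⟨_, fun p hp => hp.1, hcompl M hM⟩
    let L : BooleanSubalgebra (Completion T) :=
      { carrier := {a | ∃ M : Set T, (∀ p ∈ M, (p : α) ∈ S) ∧ a = sSup (Completion.of '' M)}
        supClosed' := fun _ ha _ hb => hsup ha hb
        infClosed' := fun a ha b hb => by
          have := hc (hsup (hc ha) (hc hb))
          rwa [← compl_inf, compl_compl] at this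
        compl_mem' := hc
        bot_mem' := ⟨∅, by simp, by simp⟩ }
    refine BooleanSubalgebra.mem_sInf.1 ha L ⟨?_, fun N hN => hS N hN⟩
    rintro _ ⟨p, hp, rfl⟩
    exact ⟨{p}, by simpa using hp, by simp⟩
  · rintro ⟨M, hM, rfl⟩
    refine sSup_mem_completeClosure ?_
    rintro _ ⟨p, hp, rfl⟩
    exact subset_completeClosure _ ⟨p, hM p hp, rfl⟩

/-- If `S` is completely contained in `T`, then `S` is dense in `subCompletion S T`. -/
theorem exists_of_le_of_mem_subCompletion (h : CompletelyContained S T) {a : Completion T}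
    (ha : a ∈ subCompletion S T) (hne : a ≠ ⊥) :
    ∃ p : T, (p : α) ∈ S ∧ Completion.of p ≤ a := by
  obtain ⟨M, hM, rfl⟩ := (mem_subCompletion_iff h).1 ha
  by_contra! hcon
  refine hne (le_bot_iff.1 (sSup_le ?_))
  rintro _ ⟨p, hp, rfl⟩
  exact (hcon p (hM p hp) (le_sSup ⟨p, hp, rfl⟩)).elim

/-- If `S` is completely contained in `T`, then `subCompletion S T` is isomorphic to `B(S)`. -/
theorem nonempty_completion_orderIso (h : CompletelyContained S T) :
    Nonempty (Completion S ≃o subCompletion S T) := by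
  have hle : ∀ {P : Type u} [PartialOrder P] {p : P} {a : Completion P},
      (∀ q, p ≤ q → ¬ Disjoint (Completion.of q) a) → Completion.of p ≤ a := by
    intro P _ p a hp
    by_contra hcon
    obtain ⟨t, ht⟩ := Completion.exists_of_le (fun hb => hcon (sdiff_eq_bot_iff.1 hb))
    rw [sdiff_eq, le_inf_iff] at ht
    have : Compat p t := by
      by_contra hc
      exact Completion.of_ne_bot t
        (le_bot_iff.1 ((Completion.disjoint_of_iff.2 hc) ht.1 le_rfl))
    obtain ⟨r, h1, h2⟩ := this
    exact hp r h1 (le_compl_iff_disjoint_right.1 ((Completion.of_anti h2).trans ht.2))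
  let i : S → T := Set.inclusion h.subset
  have hsame : ∀ {M : Set S} {p : S}, Completion.of p ≤ sSup (Completion.of '' M) ↔
      Completion.of (i p) ≤ sSup (Completion.of '' (i '' M)) := by
    intro M p
    constructor
    · intro hp
      refine hle fun q hq hd => ?_
      obtain ⟨s, hs⟩ := h.reduction q
      obtain ⟨r, h1, h2⟩ := hs s le_rfl
      obtain ⟨s', h3, h4⟩ := h.compat s p ⟨r, h1, hq.trans h2⟩
      have h5 : ¬ Disjoint (Completion.of s') (sSup (Completion.of '' M)) := fun hd' =>
        Completion.of_ne_bot s' (le_bot_iff.1 (hd' le_rfl ((Completion.of_anti h4).trans hp)))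
      rw [disjoint_sSup_iff] at h5
      push Not at h5
      obtain ⟨_, ⟨m, hm, rfl⟩, h6⟩ := h5
      rw [Completion.disjoint_of_iff, not_not] at h6
      obtain ⟨w, h7, h8⟩ := h6
      obtain ⟨x, h9, h10⟩ := hs w (h3.trans h7)
      have h11 : i m ≤ x := le_trans (show i m ≤ i w from h8) h9
      exact Completion.of_ne_bot x (le_bot_iff.1 (hd (Completion.of_anti h10)
        ((Completion.of_anti h11).trans (le_sSup ⟨_, ⟨m, hm, rfl⟩, rfl⟩))))
    · intro hp
      refine hle fun q hq hd => ?_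
      have h5 : ¬ Disjoint (Completion.of (i q)) (sSup (Completion.of '' (i '' M))) := fun hd' =>
        Completion.of_ne_bot (i q) (le_bot_iff.1 (hd' le_rfl
          ((Completion.of_anti (show i p ≤ i q from hq)).trans hp)))
      rw [disjoint_sSup_iff] at h5
      push Not at h5
      obtain ⟨_, ⟨_, ⟨m, hm, rfl⟩, rfl⟩, h6⟩ := h5
      rw [Completion.disjoint_of_iff, not_not] at h6
      obtain ⟨w, h7, h8⟩ := h.compat _ _ h6
      exact Completion.of_ne_bot w (le_bot_iff.1 (hd (Completion.of_anti h7)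
        ((Completion.of_anti h8).trans (le_sSup ⟨m, hm, rfl⟩))))
  have hsum : ∀ a : Completion S, a = sSup (Completion.of '' {p | Completion.of p ≤ a}) := by
    intro a
    refine le_antisymm ?_ (sSup_le (by rintro _ ⟨p, hp, rfl⟩; exact hp))
    by_contra hcon
    obtain ⟨t, ht⟩ := Completion.exists_of_le (fun hb => hcon (sdiff_eq_bot_iff.1 hb))
    rw [sdiff_eq, le_inf_iff] at ht
    exact Completion.of_ne_bot t (le_bot_iff.1
      (disjoint_compl_right
        (le_sSup (Set.mem_image_of_mem Completion.of (show t ∈ {p | _ ≤ a} from ht.1))) ht.2))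
  let F : Completion S → subCompletion S T := fun a =>
    ⟨sSup (Completion.of '' (i '' {p | Completion.of p ≤ a})),
      (mem_subCompletion_iff h).2 ⟨_, by rintro _ ⟨p, -, rfl⟩; exact p.2, rfl⟩⟩
  have hF : ∀ a p, Completion.of p ≤ a ↔ Completion.of (i p) ≤ (F a : Completion T) := by
    intro a p
    conv_lhs => rw [hsum a]
    exact hsame
  have hFle : ∀ a b, F a ≤ F b ↔ a ≤ b := by
    intro a b
    constructor
    · intro hab
      rw [hsum a]
      refine sSup_le ?_
      rintro _ ⟨p, hp, rfl⟩
      exact (hF b p).2 (((hF a p).1 hp).trans hab)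
    · intro hab
      change sSup (Completion.of '' (i '' {p | Completion.of p ≤ a})) ≤
        sSup (Completion.of '' (i '' {p | Completion.of p ≤ b}))
      exact sSup_le_sSup (Set.image_mono (Set.image_mono fun p hp => le_trans hp hab))
  have hsurj : Function.Surjective F := by
    rintro ⟨b, hb⟩
    obtain ⟨M, hM, rfl⟩ := (mem_subCompletion_iff h).1 hb
    refine ⟨sSup (Completion.of '' (i ⁻¹' M)), Subtype.ext (le_antisymm ?_ ?_)⟩
    · refine sSup_le ?_
      rintro _ ⟨_, ⟨p, hp, rfl⟩, rfl⟩
      exact (hsame.1 hp).trans (sSup_le_sSup (Set.image_mono (Set.image_preimage_subset _ _)))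
    · refine sSup_le ?_
      rintro _ ⟨p, hp, rfl⟩
      have hp' : (⟨p, hM p hp⟩ : S) ∈ i ⁻¹' M := hp
      exact le_sSup ⟨p, ⟨⟨p, hM p hp⟩, le_sSup (Set.mem_image_of_mem Completion.of hp'), rfl⟩, rfl⟩
  exact ⟨(RelIso.ofSurjective (OrderEmbedding.ofMapLEIff F hFle) hsurj)⟩

end

/-! ### Clubs in `[κ]^μ` -/

/-- `C` is a club subset of `[κ]^μ`: it consists of subsets of `κ` of size `μ`, it is unbounded, and it
is closed under unions of nonempty chains of length at most `μ`. -/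
structure IsClubIn {κ : Type u} (μ : Cardinal.{u}) (C : Set (Set κ)) : Prop where
  card : ∀ X ∈ C, #X = μ
  unbounded : ∀ S : Set κ, #S = μ → ∃ X ∈ C, S ⊆ X
  closed : ∀ K : Set (Set κ), K ⊆ C → K.Nonempty → IsChain (· ⊆ ·) K → #K ≤ μ → ⋃₀ K ∈ C

/-!
An isomorphism `φ : B(Q_κ) ≃ B(P_κ)` need not match `B_X` with `A_X`, but it does for club many
`X`: by the countable chain condition every element of either algebra lies in some `A_Y` or `B_Y`
with `Y` countable, so `φ` and its inverse move the conditions indexed by a finite set into a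
countable index set, and a closing-off argument applies. For `X` in this club and `Y` countable, `φ`
places `B_{X ∪ Y}` between `A_X` and `A_{X ∪ Z}` for some countable `Z`. Finally, countable relative
π-weight over `A_X` passes from `A_{X ∪ Z}` to any intermediate complete subalgebra `C`: if `S` and
`A_X` generate a dense subalgebra of `A_{X ∪ Z}`, then the upper projections to `C` of the elements
generated by `S`, together with `A_X`, generate a dense subalgebra of `C`.
-/

/-! ### Generated subalgebras -/

section BooleanAlgebra

variable {D : Type u} [BooleanAlgebra D]

theorem mem_supClosure_image2_inf_of_mem_sup {L M : BooleanSubalgebra D} {x : D}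
    (hx : x ∈ L ⊔ M) : x ∈ supClosure (Set.image2 (· ⊓ ·) (L : Set D) M) := by
  set S := Set.image2 (· ⊓ ·) (L : Set D) M
  have inf_mem_S {a b : D} (ha : a ∈ L) (hb : b ∈ M) : a ⊓ b ∈ supClosure S :=
    subset_supClosure ⟨a, ha, b, hb, rfl⟩
  have left_mem {a : D} (ha : a ∈ L) : a ∈ supClosure S := by
    simpa using inf_mem_S ha M.top_mem
  have right_mem {b : D} (hb : b ∈ M) : b ∈ supClosure S := by
    simpa using inf_mem_S L.top_mem hb
  have infClosed_S : InfClosed S := by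
    rintro _ ⟨a, ha, b, hb, rfl⟩ _ ⟨a', ha', b', hb', rfl⟩
    exact ⟨a ⊓ a', L.inf_mem ha ha', b ⊓ b', M.inf_mem hb hb', inf_inf_inf_comm ..⟩
  have infClosed_supClosure : InfClosed (supClosure S) := infClosed_S.supClosure
  have compl_mem : supClosure S ⊆ {y | yᶜ ∈ supClosure S} := by
    refine supClosure_min ?_ fun y hy z hz => ?_
    · rintro _ ⟨a, ha, b, hb, rfl⟩
      simpa only [Set.mem_ofPred_eq, compl_inf] using
        supClosed_supClosure (left_mem (L.compl_mem ha)) (right_mem (M.compl_mem hb))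
    · simpa only [Set.mem_ofPred_eq, compl_sup] using infClosed_supClosure hy hz
  let N : BooleanSubalgebra D :=
    { carrier := supClosure S
      supClosed' := supClosed_supClosure
      infClosed' := infClosed_supClosure
      compl_mem' := fun h => compl_mem h
      bot_mem' := left_mem L.bot_mem }
  exact (sup_le (fun _ => left_mem) (fun _ => right_mem) : L ⊔ M ≤ N) hx

theorem exists_inf_le_of_mem_sup {L M : BooleanSubalgebra D} {x : D} (hx : x ∈ L ⊔ M)
    (hne : x ≠ ⊥) : ∃ a ∈ L, ∃ b ∈ M, a ⊓ b ≠ ⊥ ∧ a ⊓ b ≤ x := by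
  let T : Set D := {y | y ≠ ⊥ → ∃ a ∈ L, ∃ b ∈ M, a ⊓ b ≠ ⊥ ∧ a ⊓ b ≤ y}
  suffices supClosure (Set.image2 (· ⊓ ·) (L : Set D) M) ⊆ T from
    this (mem_supClosure_image2_inf_of_mem_sup hx) hne
  refine supClosure_min ?_ fun y hy z hz hyz => ?_
  · rintro _ ⟨a, ha, b, hb, rfl⟩ hab
    exact ⟨a, ha, b, hb, hab, le_rfl⟩
  · rcases eq_or_ne y ⊥ with rfl | hy0
    · simpa using hz (by simpa using hyz)
    · obtain ⟨a, ha, b, hb, hab, hle⟩ := hy hy0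
      exact ⟨a, ha, b, hb, hab, hle.trans le_sup_left⟩

end BooleanAlgebra

/-! ### Sets closed under a function on finite subsets -/

section ClosedUnder

variable {κ : Type u} {G : Finset κ → Set κ}

/-- `X` is closed under the set-valued function `G` on finite sets, i.e. `X` is a closure point
of `G`. -/
def IsClosedUnder (G : Finset κ → Set κ) (X : Set κ) : Prop :=
  ∀ e : Finset κ, ↑e ⊆ X → G e ⊆ X

theorem isClosedUnder_sUnion {K : Set (Set κ)} (hne : K.Nonempty) (hK : DirectedOn (· ⊆ ·) K)
    (hG : ∀ X ∈ K, ∃ Y ∈ K, ∀ e : Finset κ, ↑e ⊆ X → G e ⊆ Y) : IsClosedUnder G (⋃₀ K) := by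
  intro e he
  obtain ⟨X, hX, heX⟩ :=
    hK.exists_mem_subset_of_finite_of_subset_sUnion hne e.finite_toSet he
  obtain ⟨Y, hY, hXY⟩ := hG X hX
  exact (hXY e heX).trans (Set.subset_sUnion_of_mem hY)

variable {μ : Cardinal.{u}}

theorem mk_finset_le (hμ : ℵ₀ ≤ μ) {X : Set κ} (hX : #X ≤ μ) : #(Finset X) ≤ μ := by
  cases finite_or_infinite X
  · exact mk_le_aleph0.trans hμ
  · rwa [mk_finset_of_infinite]

theorem exists_superset_forall_subset (hμ : ℵ₀ ≤ μ) (hG : ∀ e, #(G e) ≤ μ) {X : Set κ}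
    (hX : #X ≤ μ) : ∃ Y : Set κ, #Y ≤ μ ∧ X ⊆ Y ∧ ∀ e : Finset κ, ↑e ⊆ X → G e ⊆ Y := by
  refine ⟨X ∪ ⋃ e : Finset X, G (e.map (.subtype _)), ?_, Set.subset_union_left, fun e he => ?_⟩
  · exact (mk_union_le _ _).trans (add_le_of_le hμ hX ((mk_iUnion_le _).trans
      (mul_le_of_le hμ (mk_finset_le hμ hX) (ciSup_le' fun _ => hG _))))
  · classical
    rw [← Finset.subtype_map_of_mem he]
    exact (Set.subset_iUnion (fun e : Finset X => G (e.map (.subtype _))) _).trans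
      Set.subset_union_right

theorem exists_superset_isClosedUnder (hμ : ℵ₀ ≤ μ) (hG : ∀ e, #(G e) ≤ μ) {S : Set κ}
    (hS : #S ≤ μ) : ∃ X : Set κ, #X ≤ μ ∧ S ⊆ X ∧ IsClosedUnder G X := by
  choose F hF hsub hGF using fun X : {X : Set κ // #X ≤ μ} =>
    exists_superset_forall_subset hμ hG X.2
  let X : ℕ → {X : Set κ // #X ≤ μ} := fun n => (fun X => ⟨F X, hF X⟩)^[n] ⟨S, hS⟩
  have X_succ (n : ℕ) : (X (n + 1) : Set κ) = F (X n) := by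
    simp only [X, Function.iterate_succ_apply']
  have X_mono : Monotone fun n => (X n : Set κ) :=
    monotone_nat_of_le_succ fun n => (hsub (X n)).trans (X_succ n).ge
  refine ⟨⋃₀ Set.range fun n => (X n : Set κ), ?_, Set.subset_sUnion_of_mem ⟨0, rfl⟩, ?_⟩
  · refine (mk_sUnion_le _).trans (mul_le_of_le hμ ?_ (ciSup_le' ?_))
    · exact (Set.countable_range _).le_aleph0.trans hμ
    · rintro ⟨_, n, rfl⟩
      exact (X n).2
  · refine isClosedUnder_sUnion (Set.range_nonempty _) (directedOn_range.2 X_mono.directed_le) ?_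
    rintro _ ⟨n, rfl⟩
    exact ⟨_, ⟨n + 1, rfl⟩, fun e he => (hGF (X n) e he).trans (X_succ n).ge⟩

theorem isClubIn_setOf_isClosedUnder (hμ : ℵ₀ ≤ μ) (hG : ∀ e, #(G e) ≤ μ) :
    IsClubIn μ {X : Set κ | #X = μ ∧ IsClosedUnder G X} where
  card _ hX := hX.1
  unbounded S hS := by
    obtain ⟨X, hX, hSX, hclosed⟩ := exists_superset_isClosedUnder hμ hG hS.le
    exact ⟨X, ⟨hX.antisymm (hS.ge.trans (mk_le_mk_of_subset hSX)), hclosed⟩, hSX⟩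
  closed K hK hne hchain hcard := by
    have ⟨X, hX⟩ := hne
    refine ⟨le_antisymm ?_ ?_, isClosedUnder_sUnion hne hchain.directedOn fun Y hY =>
      ⟨Y, hY, (hK hY).2⟩⟩
    · exact (mk_sUnion_le _).trans (mul_le_of_le hμ hcard (ciSup_le' fun Y => (hK Y.2).1.le))
    · exact (hK hX).1.ge.trans (mk_le_mk_of_subset (Set.subset_sUnion_of_mem hX))

theorem mk_closure_le {D : Type u} [BooleanAlgebra D] (A : Set D) :
    #(BooleanSubalgebra.closure A) ≤ max ℵ₀ #A := by
  classical
  let G : Finset D → Set D := fun e =>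
    ↑(insert ⊥ (e.image compl ∪ Finset.image₂ (· ⊔ ·) e e ∪ Finset.image₂ (· ⊓ ·) e e))
  obtain ⟨X, hX, hAX, hclosed⟩ := exists_superset_isClosedUnder (G := G) (le_max_left ℵ₀ #A)
    (fun e => (Finset.countable_toSet _).le_aleph0.trans (le_max_left _ _)) (le_max_right ℵ₀ #A)
  have pair_subset {a b : D} (ha : a ∈ X) (hb : b ∈ X) : G {a, b} ⊆ X :=
    hclosed _ (by simp [Set.insert_subset_iff, ha, hb])
  let N : BooleanSubalgebra D :=
    { carrier := X
      supClosed' := fun a ha b hb => pair_subset ha hb (by simp [G])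
      infClosed' := fun a ha b hb => pair_subset ha hb (by simp [G])
      compl_mem' := fun {a} ha => pair_subset ha ha (by simp [G])
      bot_mem' := hclosed ∅ (by simp) (by simp [G]) }
  exact (mk_le_mk_of_subset (BooleanSubalgebra.closure_le.2 hAX :
    BooleanSubalgebra.closure A ≤ N)).trans hX

end ClosedUnder

/-! ### Relative π-weight -/

section RelPiWeight

/-- `A` is a π-base of `C` over `B`, up to generation: `A ⊆ C` and `A ∪ B` generates a dense
subalgebra of `C`. The least size of such a set is `relPiWeight C B`. -/
structure IsRelPiBase {D : Type u} [BooleanAlgebra D] (A : Set D) (C B : BooleanSubalgebra D) :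
    Prop where
  subset : A ⊆ C
  dense : ∀ d ∈ C, d ≠ ⊥ → ∃ x ∈ BooleanSubalgebra.closure (A ∪ (B : Set D)), x ≠ ⊥ ∧ x ≤ d

section BooleanAlgebra

variable {D D' : Type u} [BooleanAlgebra D] [BooleanAlgebra D']

theorem IsRelPiBase.relPiWeight_le {A : Set D} {C B : BooleanSubalgebra D}
    (hA : IsRelPiBase A C B) : relPiWeight C B ≤ #A :=
  csInf_le' ⟨A, hA.subset, rfl, hA.dense⟩

theorem exists_isRelPiBase (C B : BooleanSubalgebra D) :
    ∃ A : Set D, IsRelPiBase A C B ∧ #A = relPiWeight C B := by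
  have hne : {c | ∃ A : Set D, A ⊆ C ∧ #A = c ∧ ∀ d ∈ C, d ≠ ⊥ →
      ∃ x ∈ BooleanSubalgebra.closure (A ∪ (B : Set D)), x ≠ ⊥ ∧ x ≤ d}.Nonempty :=
    ⟨#C, C, subset_rfl, rfl, fun d hd hne =>
      ⟨d, BooleanSubalgebra.mem_closure_of_mem (Or.inl hd), hne, le_rfl⟩⟩
  obtain ⟨A, hAC, hcard, hdense⟩ := csInf_mem hne
  exact ⟨A, ⟨hAC, hdense⟩, hcard⟩

theorem relPiWeight_comap_le (φ : D ≃o D') (C B : BooleanSubalgebra D') :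
    relPiWeight (C.comap (φ : BoundedLatticeHom D D')) (B.comap (φ : BoundedLatticeHom D D')) ≤
      relPiWeight C B := by
  obtain ⟨A, hA, hcard⟩ := exists_isRelPiBase C B
  have hbase : IsRelPiBase (φ ⁻¹' A) (C.comap (φ : BoundedLatticeHom D D'))
      (B.comap (φ : BoundedLatticeHom D D')) := by
    refine ⟨Set.preimage_mono hA.subset, fun d hd hne => ?_⟩
    obtain ⟨x, hx, hx0, hxd⟩ := hA.dense (φ d) hd (by simpa using hne)
    refine ⟨φ.symm x, ?_, by simpa using hx0, φ.symm_apply_le.2 hxd⟩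
    suffices BooleanSubalgebra.closure (A ∪ (B : Set D')) ≤
        (BooleanSubalgebra.closure (φ ⁻¹' (A ∪ B))).comap (φ.symm : BoundedLatticeHom D' D) from
      this hx
    exact BooleanSubalgebra.closure_le.2 fun y hy =>
      BooleanSubalgebra.mem_closure_of_mem (by simpa using hy)
  calc relPiWeight _ _ ≤ #(φ ⁻¹' A) := hbase.relPiWeight_le
    _ = #A := mk_preimage_equiv φ.toEquiv A
    _ = relPiWeight C B := hcard

end BooleanAlgebra

variable {D D' : Type u} [CompleteBooleanAlgebra D] [CompleteBooleanAlgebra D']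

/-- `L` is a complete (regular) subalgebra: it is closed under arbitrary sums taken in `D`. -/
def IsCompleteSubalgebra (L : BooleanSubalgebra D) : Prop :=
  ∀ M : Set D, M ⊆ L → sSup M ∈ L

theorem IsCompleteSubalgebra.sInf_mem {L : BooleanSubalgebra D} (hL : IsCompleteSubalgebra L)
    {M : Set D} (hM : M ⊆ L) : sInf M ∈ L := by
  rw [← BooleanSubalgebra.compl_mem_iff, compl_sInf']
  refine hL _ ?_
  rintro _ ⟨a, ha, rfl⟩
  exact L.compl_mem (hM ha)

theorem IsCompleteSubalgebra.comap {L : BooleanSubalgebra D'} (hL : IsCompleteSubalgebra L)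
    (φ : D ≃o D') : IsCompleteSubalgebra (L.comap (φ : BoundedLatticeHom D D')) := by
  intro M hM
  change φ (sSup M) ∈ L
  rw [φ.map_sSup, ← sSup_image]
  exact hL _ (Set.image_subset_iff.2 hM)

theorem isCompleteSubalgebra_completeClosure (S : Set D) :
    IsCompleteSubalgebra (completeClosure S) :=
  fun _ => sSup_mem_completeClosure

theorem completeClosure_le {S : Set D} {L : BooleanSubalgebra D} (hL : IsCompleteSubalgebra L)
    (hS : S ⊆ L) : completeClosure S ≤ L :=
  sInf_le ⟨hS, hL⟩

theorem completeClosure_mono {S T : Set D} (h : S ⊆ T) : completeClosure S ≤ completeClosure T :=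
  completeClosure_le (isCompleteSubalgebra_completeClosure T) (h.trans (subset_completeClosure T))

/-- The upper projection of `D` to a complete subalgebra `C`: the least element of `C` above `d`. -/
def upperProjection (C : BooleanSubalgebra D) (d : D) : D :=
  sInf {c | c ∈ C ∧ d ≤ c}

theorem upperProjection_mem {C : BooleanSubalgebra D} (hC : IsCompleteSubalgebra C) (d : D) :
    upperProjection C d ∈ C :=
  hC.sInf_mem fun _ hc => hc.1

theorem upperProjection_inf_le_iff {C : BooleanSubalgebra D} {b c d : D} (hb : b ∈ C)
    (hc : c ∈ C) : upperProjection C d ⊓ b ≤ c ↔ d ⊓ b ≤ c := by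
  have hd : d ≤ upperProjection C d := le_sInf fun _ ha => ha.2
  refine ⟨(inf_le_inf_right b hd).trans, fun h => ?_⟩
  rw [← le_himp_iff] at h ⊢
  exact sInf_le ⟨C.himp_mem hb hc, h⟩

theorem IsRelPiBase.image_upperProjection {A : Set D} {B C E : BooleanSubalgebra D}
    (hA : IsRelPiBase A E B) (hC : IsCompleteSubalgebra C) (hBC : B ≤ C) (hCE : C ≤ E) :
    IsRelPiBase (upperProjection C '' BooleanSubalgebra.closure A) C B := by
  refine ⟨Set.image_subset_iff.2 fun d _ => upperProjection_mem hC d, fun c hc hne => ?_⟩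
  obtain ⟨x, hx, hx0, hxc⟩ := hA.dense c (hCE hc) hne
  have hle : BooleanSubalgebra.closure (A ∪ (B : Set D)) ≤ BooleanSubalgebra.closure A ⊔ B :=
    BooleanSubalgebra.closure_le.2 (Set.union_subset
      (BooleanSubalgebra.subset_closure.trans (SetLike.coe_subset_coe.2 le_sup_left))
      (SetLike.coe_subset_coe.2 le_sup_right))
  obtain ⟨a, ha, b, hb, hab, habx⟩ := exists_inf_le_of_mem_sup (hle hx) hx0
  refine ⟨upperProjection C a ⊓ b, BooleanSubalgebra.inf_mem
    (BooleanSubalgebra.mem_closure_of_mem (Or.inl ⟨a, ha, rfl⟩))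
    (BooleanSubalgebra.mem_closure_of_mem (Or.inr hb)), ?_, ?_⟩
  · rwa [ne_eq, ← le_bot_iff, upperProjection_inf_le_iff (hBC hb) C.bot_mem, le_bot_iff]
  · exact (upperProjection_inf_le_iff (hBC hb) hc).2 (habx.trans hxc)

theorem relPiWeight_le_max_of_le {B C E : BooleanSubalgebra D} (hC : IsCompleteSubalgebra C)
    (hBC : B ≤ C) (hCE : C ≤ E) : relPiWeight C B ≤ max ℵ₀ (relPiWeight E B) := by
  obtain ⟨A, hA, hcard⟩ := exists_isRelPiBase E B
  calc relPiWeight C B ≤ #(upperProjection C '' BooleanSubalgebra.closure A) :=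
        (hA.image_upperProjection hC hBC hCE).relPiWeight_le
    _ ≤ #(BooleanSubalgebra.closure A) := mk_image_le
    _ ≤ max ℵ₀ #A := mk_closure_le A
    _ = max ℵ₀ (relPiWeight E B) := by rw [hcard]

end RelPiWeight

/-! ### Completions and the countable chain condition -/

theorem exists_maximal_pairwise {ι : Type u} (r : ι → ι → Prop) (s : Set ι) :
    ∃ M, Maximal (fun M => M ⊆ s ∧ M.Pairwise r) M :=
  zorn_subset {M | M ⊆ s ∧ M.Pairwise r} fun c hc hchain =>
    ⟨⋃₀ c, ⟨Set.sUnion_subset fun _ hM => (hc hM).1,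
      (Set.pairwise_sUnion hchain.directedOn).2 fun _ hM => (hc hM).2⟩,
      fun _ => Set.subset_sUnion_of_mem⟩

namespace Completion

variable {R : Type u} [PartialOrder R]

theorem exists_of_le_disjoint {a b : Completion R} (h : ¬ a ≤ b) :
    ∃ p, of p ≤ a ∧ Disjoint (of p) b := by
  obtain ⟨p, hp⟩ := exists_of_le (mt sdiff_eq_bot_iff.1 h)
  exact ⟨p, hp.trans sdiff_le, disjoint_sdiff_self_left.mono_left hp⟩

theorem exists_countable_eq_sSup_of (hR : CountableChainCondition R) (a : Completion R) :
    ∃ M : Set R, M.Countable ∧ a = sSup (of '' M) := by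
  obtain ⟨M, ⟨hMa, hanti⟩, hmax⟩ :=
    exists_maximal_pairwise (fun p q => ¬ Compat p q) {p : R | of p ≤ a}
  refine ⟨M, hR M hanti, le_antisymm ?_ (sSup_le (Set.forall_mem_image.2 hMa))⟩
  by_contra hle
  obtain ⟨t, hta, hdisj⟩ := exists_of_le_disjoint hle
  have hincompat : ∀ q ∈ M, ¬ Compat t q ∧ ¬ Compat q t := fun q hq =>
    have h := hdisj.mono_right (le_sSup (Set.mem_image_of_mem of hq))
    ⟨disjoint_of_iff.1 h, disjoint_of_iff.1 h.symm⟩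
  have htM : t ∈ M := hmax ⟨Set.insert_subset hta hMa, hanti.insert fun q hq _ => hincompat q hq⟩
    (Set.subset_insert t M) (Set.mem_insert t M)
  exact (hincompat t htM).1 ⟨t, le_rfl, le_rfl⟩

end Completion

/-! ### Finitely supported families of orders -/

section Family

variable {κ α β : Type u}

/-- The family `P` is determined by its values at finite sets: each condition in `P X` belongs to
`P e` for some finite `e ⊆ X`, and conversely. -/
def IsFinitelySupported (P : Set κ → Set α) : Prop :=
  ∀ X, P X = ⋃ e ∈ {e : Set κ | e ⊆ X ∧ e.Finite}, P e

namespace IsFinitelySupported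

variable {P : Set κ → Set α}

theorem exists_finset (hP : IsFinitelySupported P) {X : Set κ} {p : α} (hp : p ∈ P X) :
    ∃ e : Finset κ, ↑e ⊆ X ∧ p ∈ P e := by
  rw [hP X, Set.mem_iUnion₂] at hp
  obtain ⟨e, ⟨heX, hefin⟩, hpe⟩ := hp
  lift e to Finset κ using hefin
  exact ⟨e, heX, hpe⟩

theorem monotone (hP : IsFinitelySupported P) : Monotone P := by
  intro X Y hXY
  rw [hP X, hP Y]
  exact Set.biUnion_subset_biUnion_left fun e he => ⟨he.1.trans hXY, he.2⟩

end IsFinitelySupported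

theorem mk_apply_le_of_mk_le [Infinite κ] {P : Set κ → Set α} (hP : Monotone P)
    (hcard : ∀ X : Set κ, X.Infinite → #(P X) ≤ #X) {ν : Cardinal.{u}} (hν : ℵ₀ ≤ ν) {Y : Set κ}
    (hY : #Y ≤ ν) : #(P Y) ≤ ν := by
  let N : Set κ := Set.range (Infinite.natEmbedding κ)
  have hN : N.Infinite := Set.infinite_range_of_injective (Infinite.natEmbedding κ).injective
  calc #(P Y) ≤ #(P (Y ∪ N)) := mk_le_mk_of_subset (hP Set.subset_union_left)
    _ ≤ #(Y ∪ N : Set κ) := hcard _ (hN.mono Set.subset_union_right)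
    _ ≤ ν := (mk_union_le _ _).trans
      (add_le_of_le hν hY ((Set.countable_range _).le_aleph0.trans hν))

variable [PartialOrder α] [PartialOrder β] {P : Set κ → Set α} {Q : Set κ → Set β}

/-- The subalgebra `A_X` of `B(P_κ)` completely generated by `P_X`; the paper's `B_X` is
`stage Q X`. -/
noncomputable abbrev stage (P : Set κ → Set α) (X : Set κ) :
    BooleanSubalgebra (Completion (P Set.univ)) :=
  subCompletion (P X) (P Set.univ)

theorem isCompleteSubalgebra_stage (P : Set κ → Set α) (X : Set κ) :
    IsCompleteSubalgebra (stage P X) :=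
  isCompleteSubalgebra_completeClosure _

theorem of_mem_stage {X : Set κ} {p : P Set.univ} (hp : (p : α) ∈ P X) :
    Completion.of p ∈ stage P X :=
  subset_completeClosure _ ⟨p, hp, rfl⟩

theorem stage_mono (hP : Monotone P) : Monotone (stage P) := fun _ _ h =>
  completeClosure_mono (Set.image_mono fun _ hp => hP h hp)

theorem stage_le_comap_stage {φ : Completion (P Set.univ) ≃o Completion (Q Set.univ)}
    {X Y : Set κ} (h : ∀ p : P Set.univ, (p : α) ∈ P X → φ (Completion.of p) ∈ stage Q Y) :
    stage P X ≤ (stage Q Y).comap (φ : BoundedLatticeHom _ _) :=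
  completeClosure_le ((isCompleteSubalgebra_stage Q Y).comap φ) (Set.forall_mem_image.2 h)

theorem exists_countable_mem_stage (hccc : CountableChainCondition (P Set.univ))
    (hfin : IsFinitelySupported P) (a : Completion (P Set.univ)) :
    ∃ Y : Set κ, Y.Countable ∧ a ∈ stage P Y := by
  obtain ⟨M, hM, rfl⟩ := Completion.exists_countable_eq_sSup_of hccc a
  choose e _ he using fun p : P Set.univ => hfin.exists_finset p.2
  refine ⟨⋃ p ∈ M, e p, hM.biUnion fun p _ => (e p).countable_toSet,
    isCompleteSubalgebra_stage P _ _ (Set.image_subset_iff.2 fun p hp => ?_)⟩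
  exact of_mem_stage (hfin.monotone (Set.subset_biUnion_of_mem (u := fun p => (e p : Set κ)) hp)
    (he p))

theorem exists_stage_le_comap_stage (hccc : CountableChainCondition (Q Set.univ))
    (hfin : IsFinitelySupported Q) (φ : Completion (P Set.univ) ≃o Completion (Q Set.univ))
    {X : Set κ} {ν : Cardinal.{u}} (hν : ℵ₀ ≤ ν) (hX : #(P X) ≤ ν) :
    ∃ Y : Set κ, #Y ≤ ν ∧ stage P X ≤ (stage Q Y).comap (φ : BoundedLatticeHom _ _) := by
  choose Y hY hmem using fun p : P Set.univ =>
    exists_countable_mem_stage hccc hfin (φ (Completion.of p))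
  let S : Set (P Set.univ) := {p | (p : α) ∈ P X}
  have hS : #S ≤ ν := (mk_preimage_of_injective _ _ Subtype.val_injective).trans hX
  refine ⟨⋃ p ∈ S, Y p, ?_, stage_le_comap_stage fun p hp => ?_⟩
  · exact (mk_biUnion_le _ _).trans
      (mul_le_of_le hν hS (ciSup_le' fun p => (hY p).le_aleph0.trans hν))
  · exact stage_mono hfin.monotone (Set.subset_biUnion_of_mem (u := Y) hp) (hmem p)

theorem stage_le_comap_stage_of_isClosedUnder (hPfin : IsFinitelySupported P) (hQ : Monotone Q)
    {φ : Completion (P Set.univ) ≃o Completion (Q Set.univ)} {G : Finset κ → Set κ}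
    (hG : ∀ e : Finset κ, stage P e ≤ (stage Q (G e)).comap (φ : BoundedLatticeHom _ _))
    {X : Set κ} (hX : IsClosedUnder G X) :
    stage P X ≤ (stage Q X).comap (φ : BoundedLatticeHom _ _) :=
  stage_le_comap_stage fun _ hp =>
    have ⟨e, heX, hpe⟩ := hPfin.exists_finset hp
    stage_mono hQ (hX e heX) (hG e (of_mem_stage hpe))

theorem exists_isClubIn_forall_stage_eq_comap [Infinite κ]
    (hPccc : CountableChainCondition (P Set.univ)) (hQccc : CountableChainCondition (Q Set.univ))
    (hPfin : IsFinitelySupported P) (hQfin : IsFinitelySupported Q)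
    (hPcard : ∀ X : Set κ, X.Infinite → #(P X) ≤ #X)
    (hQcard : ∀ X : Set κ, X.Infinite → #(Q X) ≤ #X)
    (φ : Completion (Q Set.univ) ≃o Completion (P Set.univ)) {μ : Cardinal.{u}} (hμ : ℵ₀ ≤ μ) :
    ∃ C : Set (Set κ), IsClubIn μ C ∧
      ∀ X ∈ C, stage Q X = (stage P X).comap (φ : BoundedLatticeHom _ _) := by
  have hP := hPfin.monotone
  have hQ := hQfin.monotone
  have hfin (e : Finset κ) : #(e : Set κ) ≤ ℵ₀ := e.countable_toSet.le_aleph0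
  choose G hG hφ using fun e : Finset κ => exists_stage_le_comap_stage hPccc hPfin φ le_rfl
    (mk_apply_le_of_mk_le hQ hQcard le_rfl (hfin e))
  choose H hH hψ using fun e : Finset κ => exists_stage_le_comap_stage hQccc hQfin φ.symm le_rfl
    (mk_apply_le_of_mk_le hP hPcard le_rfl (hfin e))
  refine ⟨_, isClubIn_setOf_isClosedUnder (G := fun e => G e ∪ H e) hμ fun e => ?_,
    fun X hX => le_antisymm ?_ fun b hb => ?_⟩
  · exact ((mk_union_le _ _).trans (add_le_of_le le_rfl (hG e) (hH e))).trans hμ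
  · exact stage_le_comap_stage_of_isClosedUnder hQfin hP hφ fun e he =>
      Set.subset_union_left.trans (hX.2 e he)
  · have hXψ : stage P X ≤ (stage Q X).comap (φ.symm : BoundedLatticeHom _ _) :=
      stage_le_comap_stage_of_isClosedUnder hPfin hQ hψ fun e he =>
        Set.subset_union_right.trans (hX.2 e he)
    simpa using hXψ hb

end Family

theorem lemma3p1_general {κ α β : Type u} [Infinite κ] [PartialOrder α] [PartialOrder β]
    {P : Set κ → Set α} {Q : Set κ → Set β}
    (hPccc : CountableChainCondition (P Set.univ)) (hQccc : CountableChainCondition (Q Set.univ))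
    (hPfin : IsFinitelySupported P) (hQfin : IsFinitelySupported Q)
    (hPcard : ∀ X : Set κ, X.Infinite → #(P X) ≤ #X)
    (hQcard : ∀ X : Set κ, X.Infinite → #(Q X) ≤ #X)
    (hQgen : ∀ X Y, stage Q (X ∪ Y) ≤
      completeClosure ((stage Q X : Set (Completion (Q Set.univ))) ∪ stage Q Y))
    {μ ν : Cardinal.{u}} (hμ : ℵ₀ ≤ μ) (hν : ℵ₀ ≤ ν)
    (hPpi : ∀ X Y : Set κ, #Y ≤ ν → relPiWeight (stage P (X ∪ Y)) (stage P X) ≤ ν)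
    (φ : Completion (Q Set.univ) ≃o Completion (P Set.univ)) :
    ∃ C : Set (Set κ), IsClubIn μ C ∧
      ∀ X ∈ C, ∀ Y : Set κ, #Y ≤ ν → relPiWeight (stage Q (X ∪ Y)) (stage Q X) ≤ ν := by
  obtain ⟨C, hC, hCφ⟩ :=
    exists_isClubIn_forall_stage_eq_comap hPccc hQccc hPfin hQfin hPcard hQcard φ hμ
  refine ⟨C, hC, fun X hX Y hY => ?_⟩
  let copy (Z : Set κ) : BooleanSubalgebra (Completion (Q Set.univ)) :=
    (stage P Z).comap (φ : BoundedLatticeHom _ _)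
  have copy_mono : Monotone copy := fun _ _ h =>
    BooleanSubalgebra.comap_mono (stage_mono hPfin.monotone h)
  obtain ⟨Z, hZ, hYZ⟩ : ∃ Z : Set κ, #Z ≤ ν ∧ stage Q Y ≤ copy Z :=
    exists_stage_le_comap_stage hPccc hPfin φ hν (mk_apply_le_of_mk_le hQfin.monotone hQcard hν hY)
  have hle : stage Q (X ∪ Y) ≤ copy (X ∪ Z) :=
    (hQgen X Y).trans (completeClosure_le ((isCompleteSubalgebra_stage P _).comap φ)
      (Set.union_subset ((hCφ X hX).le.trans (copy_mono Set.subset_union_left))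
        (hYZ.trans (copy_mono Set.subset_union_right))))
  calc relPiWeight (stage Q (X ∪ Y)) (stage Q X)
      ≤ max ℵ₀ (relPiWeight (copy (X ∪ Z)) (stage Q X)) :=
        relPiWeight_le_max_of_le (isCompleteSubalgebra_stage Q _)
          (stage_mono hQfin.monotone Set.subset_union_left) hle
    _ = max ℵ₀ (relPiWeight (copy (X ∪ Z)) (copy X)) := by rw [hCφ X hX]
    _ ≤ max ℵ₀ (relPiWeight (stage P (X ∪ Z)) (stage P X)) :=
        max_le_max_left _ (relPiWeight_comap_le φ _ _)
    _ ≤ ν := max_le hν (hPpi X Z hZ)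

theorem lemma3p1
    {κ : Type u} (hκ : ℵ_ 2 ≤ #κ) {α β : Type u} [PartialOrder α] [PartialOrder β]
    (P : Set κ → Set α) (Q : Set κ → Set β)
    (hPsep : ∀ X, Separative (P X)) (hQsep : ∀ X, Separative (Q X))
    (hPccc : ∀ X, CountableChainCondition (P X))
    (hQccc : ∀ X, CountableChainCondition (Q X))
    (hPsub : ∀ X Y, X ⊆ Y → CompletelyContained (P X) (P Y))
    (hQsub : ∀ X Y, X ⊆ Y → CompletelyContained (Q X) (Q Y))
    (hPfin : ∀ X, P X = ⋃ e ∈ {e : Set κ | e ⊆ X ∧ e.Finite}, P e)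
    (hQfin : ∀ X, Q X = ⋃ e ∈ {e : Set κ | e ⊆ X ∧ e.Finite}, Q e)
    (hPcard : ∀ X : Set κ, X.Infinite → #(P X) ≤ #X)
    (hQcard : ∀ X : Set κ, X.Infinite → #(Q X) ≤ #X)
    (A : Set κ → BooleanSubalgebra (Completion (P Set.univ)))
    (hA : ∀ X, A X = subCompletion (P X) (P Set.univ))
    (B : Set κ → BooleanSubalgebra (Completion (Q Set.univ)))
    (hB : ∀ X, B X = subCompletion (Q X) (Q Set.univ))
    (hAgen : ∀ X Y, A (X ∪ Y) = completeClosure ((A X : Set (Completion (P Set.univ))) ∪ A Y))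
    (hBgen : ∀ X Y, B (X ∪ Y) = completeClosure ((B X : Set (Completion (Q Set.univ))) ∪ B Y))
    (hApi : ∀ X Y : Set κ, Y.Countable → relPiWeight (A (X ∪ Y)) (A X) ≤ ℵ₀)
    (hiso : Nonempty (Completion (Q Set.univ) ≃o Completion (P Set.univ))) :
    ∃ C : Set (Set κ), IsClubIn (ℵ_ 1) C ∧
      ∀ X ∈ C, ∀ Y : Set κ, Y.Countable → relPiWeight (B (X ∪ Y)) (B X) ≤ ℵ₀ := by
  obtain rfl : A = stage P := funext hA
  obtain rfl : B = stage Q := funext hB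
  obtain ⟨φ⟩ := hiso
  have : Infinite κ := infinite_iff.2 ((aleph0_le_aleph 2).trans hκ)
  simpa only [le_aleph0_iff_set_countable] using lemma3p1_general (hPccc _) (hQccc _) hPfin hQfin
    hPcard hQcard (fun X Y => (hBgen X Y).le) (aleph0_le_aleph 1) le_rfl
    (fun X Y hY => hApi X Y (le_aleph0_iff_set_countable.1 hY)) φ
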